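/- Let $G=(V,E)$ be a finite directed graph without self-loops, $N_i^-=\{j : (j,i)\in E\}$, and let $\mathcal F\subseteq 2^V$ be a fault domain; a set $F\subseteq V$ is *feasible* if $F\subseteq F^*$ for some $F^*\in\mathcal F$. For a feasible $F$, a *reduced graph* of $G$ has node set $V\setminus F$; its edges are obtained by choosing a feasible set $F_x(i)$ for each $i\in V\setminus F$ and keeping exactly the edges $(j,i)\in E$ with $i,j\notin F$ and $j\notin F_x(i)$. A *source component* of a directed graph is a strongly connected component that is not reachable from any other strongly connected component. In a synchronous iterative algorithm every node $i$ has a real input $v_i[0]$. In iteration $t\ge 1$ each fault-free node $i$ sends $v_i[t-1]$ to its outgoing neighbors and to itself, receives a vector $r_i[t]$ of values from $N_i^-\cup\{i\}$ (a missing message is replaced by a default value), and sets $v_i[t]=Z_i(r_i[t])$ for a transition function $Z_i$. In each execution the set $F$ of faulty nodes is some feasible set; faulty nodes may send arbitrary, mutually inconsistent messages, or none. The algorithm is *correct* if in every execution it satisfies - *validity*: $\min_{j\in V\setminus F}v_j[t-1]\le v_i[t]\le\max_{j\in V\setminus F}v_j[t-1]$ for all $t\ge 1$ and $i\in V\setminus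 F$; - *convergence*: $\lim_{t\to\infty}(v_i[t]-v_j[t])=0$ for all $i,j\in V\setminus F$. *Algorithm 1* is the following update. Node $i$ lists the nodes of $N_i^-\cup\{i\}$ as $D(1),\dots,D(|N_i^-|+1)$ in increasing order of the received values, breaking ties arbitrarily. Let $f_1$ be the largest number such that some feasible set $F'\subseteq N_i^-$ contains $D(1),\dots,D(f_1)$, and $f_2$ the largest number such that some feasible set $F''\subseteq N_i^-$ contains the last $f_2$ nodes of the list. Node $i$ discards the first $f_1$ and the last $f_2$ values, and $v_i[t]$ is the average of the remaining $|N_i^-|+1-f_1-f_2$ values. **Theorem 2.** Suppose that for every feasible fault set $F$, every reduced graph of $G$ corresponding to $F$ has exactly one source component. Then Algorithm 1, with any default value and any way of breaking ties, satisfies validity and convergence in every execution with a feasible set of faulty nodes. In particular, a correct iterative algorithm for $G$ and $\mathcal F$ exists (namely Algorithm 1). -/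

import Mathlib

namespace IterConsensus

/-! ### Directed graphs: strongly connected components and source components -/

/-- There is a directed path (possibly of length zero) from `i` to `j` in `H`. -/
def Reach {W : Type*} (H : Digraph W) (i j : W) : Prop :=
  Relation.ReflTransGen H.Adj i j

/-- Two nodes are equivalent if they have directed paths to each other. -/
def mutualReach {W : Type*} (H : Digraph W) : Setoid W where
  r i j := Reach H i j ∧ Reach H j i
  iseqv :=
    { refl := fun _ => ⟨Relation.ReflTransGen.refl, Relation.ReflTransGen.refl⟩
      symm := fun h => ⟨h.2, h.1⟩
      trans := fun h k => ⟨h.1.trans k.1, k.2.trans h.2⟩ }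

/-- The strongly connected components of `H`. -/
def SCC {W : Type*} (H : Digraph W) : Type _ := Quotient (mutualReach H)

/-- The strongly connected component of `H` that contains the node `i`. -/
def SCC.of {W : Type*} (H : Digraph W) (i : W) : SCC H := Quotient.mk (mutualReach H) i

/-- The decomposition graph of `H`: its vertices are the strongly connected components, with an
edge from `c` to `d` iff nodes of `c` have directed paths in `H` to nodes of `d`. -/
def decompositionGraph {W : Type*} (H : Digraph W) : Digraph (SCC H) where
  Adj c d := ∃ i j : W, SCC.of H i = c ∧ SCC.of H j = d ∧ Reach H i j

/-- A source component: a strongly connected component that is not reachable, in the decomposition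
graph, from any other one. -/
def IsSourceComponent {W : Type*} (H : Digraph W) (c : SCC H) : Prop :=
  ∀ d : SCC H, d ≠ c → ¬ Reach (decompositionGraph H) d c

/-! ### Generalized fault model and reduced graphs -/

/-- `F` is a feasible fault set for the fault domain `𝓕`. -/
def Feasible {V : Type*} (𝓕 : Set (Set V)) (F : Set V) : Prop :=
  ∃ Fstar ∈ 𝓕, F ⊆ Fstar

/-- The reduced graph of `G` on the nodes outside `F`, for the chosen sets `Fx i`:
the link `(j, i)` is removed when `j ∈ Fx i`. -/
def reducedGraph {V : Type*} (G : Digraph V) (F : Set V) (Fx : ↥Fᶜ → Set V) :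
    Digraph ↥Fᶜ where
  Adj j i := G.Adj j i ∧ (j : V) ∉ Fx i

/-- Every reduced graph of `G`, for every feasible fault set `F` and every choice of feasible fault
sets `Fx i`, has exactly one source component. -/
def SourceCondition {V : Type*} (G : Digraph V) (𝓕 : Set (Set V)) : Prop :=
  ∀ F : Set V, Feasible 𝓕 F → ∀ Fx : ↥Fᶜ → Set V, (∀ i, Feasible 𝓕 (Fx i)) →
    ∃! c : SCC (reducedGraph G F Fx), IsSourceComponent (reducedGraph G F Fx) c

/-! ### Iterative algorithms and their executions -/

/-- The incoming neighbors of `i`. -/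
def inNbrs {V : Type*} (G : Digraph V) (i : V) : Set V := {j | G.Adj j i}

/-- The nodes from which `i` receives a value: its incoming neighbors and `i` itself. -/
def senders {V : Type*} (G : Digraph V) (i : V) : Set V := insert i (inNbrs G i)

/-- A (possibly nondeterministic) update step: `U i r y` says that node `i`, having received the
vector `r`, may take `y` as its new state. -/
abbrev UpdateRule {V : Type*} (G : Digraph V) : Type _ :=
  (i : V) → (↥(senders G i) → ℝ) → ℝ → Prop

/-- The record of a run. `state t i` is the state of node `i` at the end of iteration `t`
(`state 0 i` is its input), and `sent t j i` is the message transmitted by `j` to `i` in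
iteration `t ≥ 1`, where `none` means that no message was transmitted. The states of faulty nodes
have no meaning. -/
structure Run (V : Type*) where
  state : ℕ → V → ℝ
  sent : ℕ → V → V → Option ℝ

/-- The vector of values that node `i` receives in iteration `t`; a missing message is replaced
by the default value. -/
def Run.received {V : Type*} (x : Run V) (G : Digraph V) (dflt : ℝ) (t : ℕ) (i : V) :
    ↥(senders G i) → ℝ :=
  fun j => (x.sent t j i).getD dflt

/-- `x` is an execution, with set of faulty nodes `F`, of the iterative algorithm with update rule
`U`: in every iteration each fault-free node transmits its current state on all outgoing edges and
to itself, and then updates its state according to `U`. Nothing is required of faulty nodes, which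
may send arbitrary and mismatching messages, or none. -/
structure IsExecution {V : Type*} (G : Digraph V) (U : UpdateRule G) (dflt : ℝ) (F : Set V)
    (x : Run V) : Prop where
  transmit : ∀ (t : ℕ) (j : V), j ∉ F → ∀ i : V, j ∈ senders G i →
    x.sent (t + 1) j i = some (x.state t j)
  update : ∀ (t : ℕ) (i : V), i ∉ F →
    U i (x.received G dflt (t + 1) i) (x.state (t + 1) i)

/-- Validity: each fault-free state stays between the minimum and the maximum of the fault-free
states at the end of the previous iteration (the node set is finite, so infimum and supremum are
minimum and maximum). -/
def Validity {V : Type*} (F : Set V) (v : ℕ → V → ℝ) : Prop :=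
  ∀ (t : ℕ) (i : V), i ∉ F →
    (⨅ j : ↥Fᶜ, v t j) ≤ v (t + 1) i ∧ v (t + 1) i ≤ ⨆ j : ↥Fᶜ, v t j

/-- Convergence: differences of fault-free states tend to zero. -/
def Convergence {V : Type*} (F : Set V) (v : ℕ → V → ℝ) : Prop :=
  ∀ i j : V, i ∉ F → j ∉ F →
    Filter.Tendsto (fun t => v t i - v t j) Filter.atTop (nhds 0)

/-- The algorithm with update rule `U` satisfies validity and convergence in every execution
whose set of faulty nodes is feasible. -/
def SatisfiesValidityAndConvergence {V : Type*} (G : Digraph V) (𝓕 : Set (Set V))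
    (U : UpdateRule G) (dflt : ℝ) : Prop :=
  ∀ F : Set V, Feasible 𝓕 F → ∀ x : Run V, IsExecution G U dflt F x →
    Validity F x.state ∧ Convergence F x.state

/-- An iterative approximate consensus algorithm: a transition function for each node, applied to
the received vector, and the default value used for missing messages. -/
structure IABC {V : Type*} (G : Digraph V) where
  dflt : ℝ
  Z : (i : V) → (↥(senders G i) → ℝ) → ℝ

/-- The algorithm is correct: validity and convergence hold in every execution. -/
def IABC.Correct {V : Type*} {G : Digraph V} (A : IABC G) (𝓕 : Set (Set V)) : Prop :=
  SatisfiesValidityAndConvergence G 𝓕 (fun i r y => y = A.Z i r) A.dflt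

/-! ### The trimmed-mean algorithm -/

/-- An arrangement of the senders of `i`, with positions numbered from `0` to `|N_i^-|`. -/
abbrev Arrangement {V : Type*} (G : Digraph V) (i : V) : Type _ :=
  Fin ((inNbrs G i).ncard + 1) ≃ ↥(senders G i)

/-- Numbers `m` such that some feasible fault set of incoming neighbors of `i` contains the first
`m` nodes of the arrangement. -/
def lowCandidates {V : Type*} (G : Digraph V) (𝓕 : Set (Set V)) (i : V) (D : Arrangement G i) :
    Set ℕ :=
  {m | ∃ F' : Set V, Feasible 𝓕 F' ∧ F' ⊆ inNbrs G i ∧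
    ∀ k : Fin ((inNbrs G i).ncard + 1), (k : ℕ) < m → (D k : V) ∈ F'}

/-- Numbers `m` such that some feasible fault set of incoming neighbors of `i` contains the last
`m` nodes of the arrangement. -/
def highCandidates {V : Type*} (G : Digraph V) (𝓕 : Set (Set V)) (i : V) (D : Arrangement G i) :
    Set ℕ :=
  {m | ∃ F'' : Set V, Feasible 𝓕 F'' ∧ F'' ⊆ inNbrs G i ∧
    ∀ k : Fin ((inNbrs G i).ncard + 1), (inNbrs G i).ncard + 1 ≤ (k : ℕ) + m → (D k : V) ∈ F''}

/-- `f₁`: the largest low candidate (attained, see below; `0` if no set at all is feasible). -/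
noncomputable def f₁ {V : Type*} (G : Digraph V) (𝓕 : Set (Set V)) (i : V)
    (D : Arrangement G i) : ℕ :=
  sSup (lowCandidates G 𝓕 i D)

/-- `f₂`: the largest high candidate (attained, see below; `0` if no set at all is feasible). -/
noncomputable def f₂ {V : Type*} (G : Digraph V) (𝓕 : Set (Set V)) (i : V)
    (D : Arrangement G i) : ℕ :=
  sSup (highCandidates G 𝓕 i D)

/-- The positions of the nodes whose values remain after the first `f₁` and the last `f₂` values
are eliminated. -/
noncomputable def remaining {V : Type*} (G : Digraph V) (𝓕 : Set (Set V)) (i : V)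
    (D : Arrangement G i) : Finset (Fin ((inNbrs G i).ncard + 1)) :=
  Finset.univ.filter fun k =>
    f₁ G 𝓕 i D ≤ (k : ℕ) ∧ (k : ℕ) + f₂ G 𝓕 i D < (inNbrs G i).ncard + 1

/-- The update step of the trimmed-mean algorithm: arrange the senders in increasing order of the received
values, ties being broken arbitrarily, eliminate the first `f₁` and the last `f₂` values, and take
the average of the remaining ones. -/
def trimmedMean {V : Type*} (G : Digraph V) (𝓕 : Set (Set V)) : UpdateRule G :=
  fun i r y => ∃ D : Arrangement G i, Monotone (fun k => r (D k)) ∧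
    y = ∑ k ∈ remaining G 𝓕 i D, (1 / ((remaining G 𝓕 i D).card : ℝ)) * r (D k)

/-- `A` carries out the trimmed-mean algorithm, with some way of breaking ties. -/
def IABC.ImplementsTrimmedMean {V : Type*} {G : Digraph V} (A : IABC G) (𝓕 : Set (Set V)) : Prop :=
  ∀ (i : V) (r : ↥(senders G i) → ℝ), trimmedMean G 𝓕 i r (A.Z i r)

/-- The supremum defining `f₁` is attained. -/
theorem isGreatest_f₁ {V : Type*} (G : Digraph V) (hG : ∀ i, ¬ G.Adj i i) (𝓕 : Set (Set V))
    (h𝓕 : 𝓕.Nonempty) (i : V) (D : Arrangement G i) :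
    IsGreatest (lowCandidates G 𝓕 i D) (f₁ G 𝓕 i D) := by
  obtain ⟨S, hS⟩ := h𝓕
  refine ⟨Nat.sSup_mem ⟨0, ∅, ⟨S, hS, by simp⟩, by simp, by simp⟩ ?_, fun m hm => le_csSup ?_ hm⟩
  all_goals
    refine ⟨(inNbrs G i).ncard + 1, ?_⟩
    rintro m ⟨F', -, hF', h⟩
    by_contra! hm
    have h1 := h (D.symm ⟨i, Set.mem_insert _ _⟩) (by omega)
    rw [Equiv.apply_symm_apply] at h1
    exact hG i (hF' h1)

/-- The supremum defining `f₂` is attained. -/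
theorem isGreatest_f₂ {V : Type*} (G : Digraph V) (hG : ∀ i, ¬ G.Adj i i) (𝓕 : Set (Set V))
    (h𝓕 : 𝓕.Nonempty) (i : V) (D : Arrangement G i) :
    IsGreatest (highCandidates G 𝓕 i D) (f₂ G 𝓕 i D) := by
  obtain ⟨S, hS⟩ := h𝓕
  refine ⟨Nat.sSup_mem ⟨0, ∅, ⟨S, hS, by simp⟩, by simp, fun k hk => ?_⟩ ?_,
    fun m hm => le_csSup ?_ hm⟩
  · omega
  all_goals
    refine ⟨(inNbrs G i).ncard + 1, ?_⟩
    rintro m ⟨F', -, hF', h⟩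
    by_contra! hm
    have h1 := h (D.symm ⟨i, Set.mem_insert _ _⟩) (by omega)
    rw [Equiv.apply_symm_apply] at h1
    exact hG i (hF' h1)

end IterConsensus

/-!
The states of the fault-free nodes are controlled by a contraction of their spread, obtained by
counting, with no transition matrices.

*From the source condition to pairs of sets.* A nonempty set of nodes without incoming edges
contains a source component (`exists_isSourceComponent_of_closed`). If two disjoint nonempty sets
`L`, `R` of fault-free nodes were such that each node in either set has its fault-free incoming
neighbors from outside that set covered by a feasible set, then removing those covers would give a
reduced graph in which both `L` and `R` have no incoming edges, hence two source components. So
some node of `L` or of `R` has uncoverable outside neighbors (`SourceCondition.exists_not_covered`).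

*One update.* The value of `i` itself always survives the trimming. A surviving value cannot lie
below all fault-free values, since then its sender and all earlier ones would be faulty and would
have been discarded by the maximality of `f₁`. If the senders of values at least `m + c` cannot be
covered by a feasible set, one of these values survives, since only the last `f₂` values could have
removed them. A surviving value at least `m + c` has weight at least `1 / |V|`, so it lifts the
average to at least `m + c / |V|` (`IsExecution.lower_bound`). Upper bounds follow by negating all
values, which exchanges `f₁` and `f₂` (`IsExecution.neg`).

*Contraction.* Let the fault-free states at time `t` lie in `[m, M]`, and put `n = |V|`,
`c s = (M - m) / 2 / n ^ s`. The fault-free nodes with state below `m + c s` at time `t + s`, and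
those with state above `M - c s`, form two disjoint sets, both decreasing in `s`. As long as both
are nonempty, the pair condition makes some node leave one of them in the next round, so after `n`
rounds one of them is empty (`IsExecution.contraction`). Hence the spread shrinks by the fixed
factor `1 - 1 / (2 n ^ n)` every `n` rounds.
-/

namespace IterConsensus

/-! ### Source components -/

/-- Reachability in the decomposition graph reflects to reachability between nodes. -/
theorem reach_of_reach_decompositionGraph {W : Type*} (H : Digraph W) {c d : SCC H}
    (h : Reach (decompositionGraph H) c d) :
    ∀ i j : W, SCC.of H i = c → SCC.of H j = d → Reach H i j := by
  induction h with
  | refl =>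
    intro i j hi hj
    exact (Quotient.exact (hi.trans hj.symm) : Reach H i j ∧ Reach H j i).1
  | tail _ hbc ih =>
    intro i j hi hj
    obtain ⟨p, q, hp, hq, hpq⟩ := hbc
    have h1 : Reach H q j ∧ Reach H j q := Quotient.exact (hq.trans hj.symm)
    exact ((ih i p hi hp).trans hpq).trans h1.1

theorem mem_of_reach_of_closed {W : Type*} (H : Digraph W) {L : Set W}
    (hcl : ∀ j i, H.Adj j i → i ∈ L → j ∈ L) {i j : W} (h : Reach H j i) (hi : i ∈ L) : j ∈ L := by
  induction h using Relation.ReflTransGen.head_induction_on with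
  | refl => exact hi
  | head h1 _ ih => exact hcl _ _ h1 ih

/-- A nonempty set of nodes without incoming edges contains a source component: take the component
of a node of the set that has the fewest ancestors. -/
theorem exists_isSourceComponent_of_closed {W : Type*} [Finite W] (H : Digraph W) {L : Set W}
    (hL : L.Nonempty) (hcl : ∀ j i, H.Adj j i → i ∈ L → j ∈ L) :
    ∃ i ∈ L, IsSourceComponent H (SCC.of H i) := by
  obtain ⟨i, hi, hmin⟩ :=
    Set.exists_min_image L (fun i => {j | Reach H j i}.ncard) (Set.toFinite L) hL
  refine ⟨i, hi, fun d hd hreach => hd ?_⟩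
  obtain ⟨j, rfl⟩ := Quotient.exists_rep d
  have hji : Reach H j i := reach_of_reach_decompositionGraph H hreach j i rfl rfl
  have hsub : {k | Reach H k j} ⊆ {k | Reach H k i} := fun k hk => Relation.ReflTransGen.trans hk hji
  have heq := Set.eq_of_subset_of_ncard_le hsub (hmin j (mem_of_reach_of_closed H hcl hji hi))
  have hij : i ∈ {k | Reach H k j} := heq ▸ Relation.ReflTransGen.refl
  exact Quotient.sound ⟨hji, hij⟩

/-- Of two disjoint nonempty sets of fault-free nodes, at least one has a node whose fault-free
incoming neighbors outside the set are not covered by any feasible set. -/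
theorem SourceCondition.exists_not_covered {V : Type*} [Finite V] {G : Digraph V}
    {𝓕 : Set (Set V)} (hsource : SourceCondition G 𝓕) {F : Set V} (hF : Feasible 𝓕 F)
    {L R : Set V} (hL : L.Nonempty) (hR : R.Nonempty) (hLF : ∀ i ∈ L, i ∉ F)
    (hRF : ∀ i ∈ R, i ∉ F) (hLR : ∀ i ∈ L, i ∉ R) :
    (∃ i ∈ L, ¬ ∃ S, Feasible 𝓕 S ∧ ∀ j, G.Adj j i → j ∉ F → j ∉ L → j ∈ S) ∨
    (∃ i ∈ R, ¬ ∃ S, Feasible 𝓕 S ∧ ∀ j, G.Adj j i → j ∉ F → j ∉ R → j ∈ S) := by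
  by_contra! hcon
  obtain ⟨h1, h2⟩ := hcon
  have hex : ∀ i : ↥Fᶜ, ∃ S, Feasible 𝓕 S ∧
      ((i : V) ∈ L → ∀ j, G.Adj j i → j ∉ F → j ∉ L → j ∈ S) ∧
      ((i : V) ∈ R → ∀ j, G.Adj j i → j ∉ F → j ∉ R → j ∈ S) := by
    intro i
    by_cases hiL : (i : V) ∈ L
    · obtain ⟨S, hS, hcov⟩ := h1 i hiL
      exact ⟨S, hS, fun _ => hcov, fun hiR => absurd hiR (hLR i hiL)⟩
    · by_cases hiR : (i : V) ∈ R
      · obtain ⟨S, hS, hcov⟩ := h2 i hiR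
        exact ⟨S, hS, fun h => absurd h hiL, fun _ => hcov⟩
      · exact ⟨F, hF, fun h => absurd h hiL, fun h => absurd h hiR⟩
  choose Fx hFx hFxL hFxR using hex
  have hclosed : ∀ T : Set V, (∀ i : ↥Fᶜ, (i : V) ∈ T →
      ∀ j, G.Adj j i → j ∉ F → j ∉ T → j ∈ Fx i) → ∀ j i : ↥Fᶜ,
      (reducedGraph G F Fx).Adj j i → i ∈ {k : ↥Fᶜ | (k : V) ∈ T} →
        j ∈ {k : ↥Fᶜ | (k : V) ∈ T} := by
    intro T hT j i hji hi
    by_contra hj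
    exact hji.2 (hT i hi j hji.1 j.2 hj)
  have hLcl := hclosed L hFxL
  have hRcl := hclosed R hFxR
  obtain ⟨l, hl⟩ := hL
  obtain ⟨r, hr⟩ := hR
  obtain ⟨a, ha, hsa⟩ := exists_isSourceComponent_of_closed _ ⟨⟨l, hLF l hl⟩, hl⟩ hLcl
  obtain ⟨b, hb, hsb⟩ := exists_isSourceComponent_of_closed _ ⟨⟨r, hRF r hr⟩, hr⟩ hRcl
  have hab := (hsource F hF Fx hFx).unique hsa hsb
  have hreach : Reach (reducedGraph G F Fx) a b ∧ Reach (reducedGraph G F Fx) b a :=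
    Quotient.exact hab
  exact hLR a ha (mem_of_reach_of_closed _ hRcl hreach.1 hb)

/-! ### The trimmed mean -/

variable {V : Type*} {G : Digraph V} {𝓕 : Set (Set V)}

/-- Reversing the arrangement exchanges the two ends of the list. -/
theorem lowCandidates_revPerm_trans (i : V) (D : Arrangement G i) :
    lowCandidates G 𝓕 i (Fin.revPerm.trans D) = highCandidates G 𝓕 i D := by
  ext m
  refine exists_congr fun S => and_congr_right fun _ => and_congr_right fun _ => ?_
  refine Fin.revPerm.forall_congr fun k => ?_
  simp only [Equiv.trans_apply, Fin.revPerm_apply, Fin.val_rev]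
  have := k.2
  refine imp_congr ?_ Iff.rfl
  omega

theorem highCandidates_revPerm_trans (i : V) (D : Arrangement G i) :
    highCandidates G 𝓕 i (Fin.revPerm.trans D) = lowCandidates G 𝓕 i D := by
  rw [← lowCandidates_revPerm_trans]
  congr 1
  ext k
  simp

theorem remaining_revPerm_trans (i : V) (D : Arrangement G i) :
    remaining G 𝓕 i (Fin.revPerm.trans D) = (remaining G 𝓕 i D).map Fin.revPerm.toEmbedding := by
  ext k
  rw [Finset.mem_map_equiv, remaining, remaining, Finset.mem_filter_univ, Finset.mem_filter_univ,
    f₁, f₂, lowCandidates_revPerm_trans, highCandidates_revPerm_trans, ← f₁, ← f₂,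
    Fin.revPerm_symm, Fin.revPerm_apply, Fin.val_rev]
  have := k.2
  omega

/-- The trimmed mean commutes with negation. -/
theorem trimmedMean_neg {i : V} {r : ↥(senders G i) → ℝ} {y : ℝ} (h : trimmedMean G 𝓕 i r y) :
    trimmedMean G 𝓕 i (-r) (-y) := by
  obtain ⟨D, hD, rfl⟩ := h
  refine ⟨Fin.revPerm.trans D, fun k l hkl => ?_, ?_⟩
  · simpa using hD (Fin.rev_le_rev.2 hkl)
  · simp [remaining_revPerm_trans, Finset.sum_map]

theorem exists_mem_remaining_eq_self (hG : ∀ i, ¬ G.Adj i i) (h𝓕 : 𝓕.Nonempty) (i : V)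
    (D : Arrangement G i) : ∃ k ∈ remaining G 𝓕 i D, (D k : V) = i := by
  obtain ⟨⟨F', -, hF', h1⟩, -⟩ := isGreatest_f₁ G hG 𝓕 h𝓕 i D
  obtain ⟨⟨F'', -, hF'', h2⟩, -⟩ := isGreatest_f₂ G hG 𝓕 h𝓕 i D
  have hk : (D (D.symm ⟨i, Set.mem_insert _ _⟩) : V) = i := by rw [Equiv.apply_symm_apply]
  refine ⟨D.symm ⟨i, Set.mem_insert _ _⟩, ?_, hk⟩
  simp only [remaining, Finset.mem_filter, Finset.mem_univ, true_and]
  constructor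
  · by_contra! hlt
    exact hG i (hF' (hk ▸ h1 _ hlt))
  · by_contra! hlt
    exact hG i (hF'' (hk ▸ h2 _ hlt))

theorem le_of_mem_remaining (hG : ∀ i, ¬ G.Adj i i) {F : Set V} (hF : Feasible 𝓕 F) {i : V}
    (hi : i ∉ F) {r : ↥(senders G i) → ℝ} {D : Arrangement G i} (hD : Monotone fun k => r (D k))
    {m : ℝ} (hm : ∀ j : ↥(senders G i), (j : V) ∉ F → m ≤ r j)
    {k : Fin ((inNbrs G i).ncard + 1)} (hk : k ∈ remaining G 𝓕 i D) : m ≤ r (D k) := by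
  by_contra! hlt
  have h𝓕 : 𝓕.Nonempty := let ⟨S, hS, _⟩ := hF; ⟨S, hS⟩
  -- Otherwise the positions up to `k` all belong to faulty nodes, so `k + 1` is a low candidate.
  have hmem : ∀ l ≤ k, (D l : V) ∈ F := by
    intro l hl
    by_contra hlF
    exact absurd ((hm _ hlF).trans (hD hl)) (not_le.2 hlt)
  have hcand : (k : ℕ) + 1 ∈ lowCandidates G 𝓕 i D := by
    obtain ⟨S, hS, hFS⟩ := hF
    refine ⟨F ∩ inNbrs G i, ⟨S, hS, Set.inter_subset_left.trans hFS⟩, Set.inter_subset_right,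
      fun l hl => ?_⟩
    have hlF := hmem l (Fin.le_def.2 (by omega))
    refine ⟨hlF, (D l).2.resolve_left fun h => hi (h ▸ hlF)⟩
  have hle := (isGreatest_f₁ G hG 𝓕 h𝓕 i D).2 hcand
  simp only [remaining, Finset.mem_filter, Finset.mem_univ, true_and] at hk
  omega

/-- If the incoming neighbors with values at least `b` cannot be covered by a feasible set, then a
value at least `b` survives the trimming. -/
theorem exists_mem_remaining_ge (hG : ∀ i, ¬ G.Adj i i) (h𝓕 : 𝓕.Nonempty) {F : Set V} {i : V}
    {r : ↥(senders G i) → ℝ} {D : Arrangement G i} (hD : Monotone fun k => r (D k)) {b : ℝ}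
    (hcov : ¬ ∃ S, Feasible 𝓕 S ∧ ∀ j : ↥(senders G i), G.Adj j i → (j : V) ∉ F → b ≤ r j →
      (j : V) ∈ S) :
    ∃ k ∈ remaining G 𝓕 i D, b ≤ r (D k) := by
  by_contra! hlt
  obtain ⟨⟨S, hS, -, hcovS⟩, -⟩ := isGreatest_f₂ G hG 𝓕 h𝓕 i D
  refine hcov ⟨S, hS, fun j _ _ hb => ?_⟩
  obtain ⟨k, rfl⟩ := D.surjective j
  refine hcovS k ?_
  obtain ⟨l, hl, -⟩ := exists_mem_remaining_eq_self hG h𝓕 i D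
  have hkl : l < k := by
    by_contra! hkl
    exact absurd (hb.trans (hD hkl)) (not_le.2 (hlt l hl))
  have hk : k ∉ remaining G 𝓕 i D := fun h => absurd hb (not_le.2 (hlt k h))
  simp only [remaining, Finset.mem_filter, Finset.mem_univ, true_and] at hl hk
  rw [Fin.lt_def] at hkl
  omega

theorem card_senders [Finite V] (hG : ∀ i, ¬ G.Adj i i) (i : V) :
    Nat.card ↥(senders G i) = (inNbrs G i).ncard + 1 :=
  Set.ncard_insert_of_notMem (hG i)

theorem card_remaining_le [Finite V] (hG : ∀ i, ¬ G.Adj i i) (i : V) (D : Arrangement G i) :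
    (remaining G 𝓕 i D).card ≤ Nat.card V := by
  calc (remaining G 𝓕 i D).card ≤ (inNbrs G i).ncard + 1 := card_finset_fin_le _
    _ = Nat.card ↥(senders G i) := (card_senders hG i).symm
    _ ≤ Nat.card V := Nat.card_le_card_of_injective _ Subtype.val_injective

/-- One value at least `m + c`, among at most `n` values that are all at least `m`, lifts their
average to at least `m + c / n`. -/
theorem add_div_le_average {κ : Type*} {s : Finset κ} {w : κ → ℝ} {m c : ℝ} {n : ℕ} (hc : 0 ≤ c)
    (hn : s.card ≤ n) (hm : ∀ k ∈ s, m ≤ w k) (hk : ∃ k ∈ s, m + c ≤ w k) :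
    m + c / n ≤ ∑ k ∈ s, (1 / (s.card : ℝ)) * w k := by
  obtain ⟨k, hks, hk⟩ := hk
  have hpos : 0 < s.card := Finset.card_pos.2 ⟨k, hks⟩
  have hpos' : (0 : ℝ) < s.card := by exact_mod_cast hpos
  have h1 : c ≤ ∑ l ∈ s, (w l - m) :=
    (by linarith : c ≤ w k - m).trans
      (Finset.single_le_sum (f := fun l => w l - m) (fun l hl => sub_nonneg.2 (hm l hl)) hks)
  rw [Finset.sum_sub_distrib, Finset.sum_const, nsmul_eq_mul] at h1
  have h2 : c / n ≤ c / s.card :=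
    div_le_div_of_nonneg_left hc hpos' (by exact_mod_cast hn)
  rw [← Finset.mul_sum]
  calc m + c / n ≤ m + c / s.card := by linarith
    _ = 1 / (s.card : ℝ) * (s.card * m + c) := by field_simp
    _ ≤ _ := by gcongr; linarith

/-- Every vector of received values can be arranged in increasing order. -/
theorem exists_trimmedMean [Finite V] (hG : ∀ i, ¬ G.Adj i i) (𝓕 : Set (Set V)) (i : V)
    (r : ↥(senders G i) → ℝ) : ∃ y, trimmedMean G 𝓕 i r y := by
  let e : Fin ((inNbrs G i).ncard + 1) ≃ ↥(senders G i) :=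
    (finCongr (card_senders hG i).symm).trans (Finite.equivFin _).symm
  exact ⟨_, (Tuple.sort (r ∘ e)).trans e, Tuple.monotone_sort (r ∘ e), rfl⟩

/-! ### Executions of the trimmed-mean algorithm -/

/-- The run in which all states and messages are negated. -/
def Run.neg (x : Run V) : Run V where
  state t i := -x.state t i
  sent t j i := (x.sent t j i).map (- ·)

theorem Run.received_neg (x : Run V) (dflt : ℝ) (t : ℕ) (i : V) :
    x.neg.received G (-dflt) t i = -x.received G dflt t i := by
  ext j
  simp only [Run.received, Run.neg, Pi.neg_apply]
  cases x.sent t j i <;> rfl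

theorem IsExecution.neg {dflt : ℝ} {F : Set V} {x : Run V}
    (hx : IsExecution G (trimmedMean G 𝓕) dflt F x) :
    IsExecution G (trimmedMean G 𝓕) (-dflt) F x.neg where
  transmit t j hj i hji := by simp [Run.neg, hx.transmit t j hj i hji]
  update t i hi := by
    rw [Run.received_neg]
    exact trimmedMean_neg (hx.update t i hi)

theorem IsExecution.received_eq {U : UpdateRule G} {dflt : ℝ} {F : Set V} {x : Run V}
    (hx : IsExecution G U dflt F x) (t : ℕ) (i : V) (j : ↥(senders G i)) (hj : (j : V) ∉ F) :
    x.received G dflt (t + 1) i j = x.state t j := by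
  simp [Run.received, hx.transmit t j hj i j.2]

/-- If all fault-free states are at least `m`, then the next state of `i` is at least
`m + c / |V|` as soon as the state of `i` is at least `m + c`, or the fault-free incoming neighbors
of `i` with states at least `m + c` are not covered by any feasible set. -/
theorem IsExecution.lower_bound [Finite V] (hG : ∀ i, ¬ G.Adj i i) {dflt : ℝ} {F : Set V}
    (hF : Feasible 𝓕 F) {x : Run V} (hx : IsExecution G (trimmedMean G 𝓕) dflt F x) {t : ℕ}
    {m c : ℝ} (hm : ∀ j ∉ F, m ≤ x.state t j) (hc : 0 ≤ c) {i : V} (hi : i ∉ F)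
    (h : m + c ≤ x.state t i ∨ ¬ ∃ S, Feasible 𝓕 S ∧
      ∀ j, G.Adj j i → j ∉ F → m + c ≤ x.state t j → j ∈ S) :
    m + c / Nat.card V ≤ x.state (t + 1) i := by
  have h𝓕 : 𝓕.Nonempty := let ⟨S, hS, _⟩ := hF; ⟨S, hS⟩
  obtain ⟨D, hD, hy⟩ := hx.update t i hi
  rw [hy]
  refine add_div_le_average hc (card_remaining_le hG i D) (fun k hk => ?_) ?_
  · refine le_of_mem_remaining hG hF hi hD (fun j hj => ?_) hk
    rw [hx.received_eq t i j hj]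
    exact hm j hj
  · rcases h with h | h
    · obtain ⟨k, hk, hki⟩ := exists_mem_remaining_eq_self hG h𝓕 i D
      refine ⟨k, hk, ?_⟩
      rwa [hx.received_eq t i _ (by rwa [hki]), hki]
    · refine exists_mem_remaining_ge (F := F) hG h𝓕 hD fun ⟨S, hS, hcov⟩ => h ⟨S, hS, ?_⟩
      intro j hji hj hb
      refine hcov ⟨j, Or.inr hji⟩ hji hj ?_
      rwa [hx.received_eq t i _ hj]

theorem IsExecution.upper_bound [Finite V] (hG : ∀ i, ¬ G.Adj i i) {dflt : ℝ} {F : Set V}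
    (hF : Feasible 𝓕 F) {x : Run V} (hx : IsExecution G (trimmedMean G 𝓕) dflt F x) {t : ℕ}
    {M c : ℝ} (hM : ∀ j ∉ F, x.state t j ≤ M) (hc : 0 ≤ c) {i : V} (hi : i ∉ F)
    (h : x.state t i ≤ M - c ∨ ¬ ∃ S, Feasible 𝓕 S ∧
      ∀ j, G.Adj j i → j ∉ F → x.state t j ≤ M - c → j ∈ S) :
    x.state (t + 1) i ≤ M - c / Nat.card V := by
  have hiff : ∀ a : ℝ, -M + c ≤ -a ↔ a ≤ M - c := fun a => by
    constructor <;> intro <;> linarith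
  have := hx.neg.lower_bound (t := t) (m := -M) (c := c) hG hF
    (fun j hj => neg_le_neg (hM j hj)) hc hi (by simpa only [Run.neg, hiff] using h)
  simp only [Run.neg] at this
  linarith

theorem IsExecution.le_state_add [Finite V] (hG : ∀ i, ¬ G.Adj i i) {dflt : ℝ} {F : Set V}
    (hF : Feasible 𝓕 F) {x : Run V} (hx : IsExecution G (trimmedMean G 𝓕) dflt F x) {t : ℕ}
    {m : ℝ} (hm : ∀ j ∉ F, m ≤ x.state t j) (s : ℕ) : ∀ j ∉ F, m ≤ x.state (t + s) j := by
  induction s with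
  | zero => exact hm
  | succ s ih =>
    intro j hj
    have := hx.lower_bound hG hF ih le_rfl hj (Or.inl (by simpa using ih j hj))
    simpa [add_assoc] using this

theorem IsExecution.state_add_le [Finite V] (hG : ∀ i, ¬ G.Adj i i) {dflt : ℝ} {F : Set V}
    (hF : Feasible 𝓕 F) {x : Run V} (hx : IsExecution G (trimmedMean G 𝓕) dflt F x) {t : ℕ}
    {M : ℝ} (hM : ∀ j ∉ F, x.state t j ≤ M) (s : ℕ) : ∀ j ∉ F, x.state (t + s) j ≤ M := by
  intro j hj
  have := hx.neg.le_state_add (t := t) (m := -M) hG hF (fun j hj => neg_le_neg (hM j hj)) s j hj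
  exact neg_le_neg_iff.1 this

/-- Over `|V|` rounds, the range `[m, M]` of the fault-free states loses a fixed proportion of its
length at one of its two ends. -/
theorem IsExecution.contraction [Finite V] (hG : ∀ i, ¬ G.Adj i i)
    (hsource : SourceCondition G 𝓕) {dflt : ℝ} {F : Set V} (hF : Feasible 𝓕 F) {x : Run V}
    (hx : IsExecution G (trimmedMean G 𝓕) dflt F x) {t : ℕ} {m M : ℝ} (hmM : m ≤ M)
    (hm : ∀ j ∉ F, m ≤ x.state t j) (hM : ∀ j ∉ F, x.state t j ≤ M) :
    (∀ j ∉ F, m + (M - m) / 2 / (Nat.card V : ℝ) ^ Nat.card V ≤ x.state (t + Nat.card V) j) ∨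
    (∀ j ∉ F, x.state (t + Nat.card V) j ≤ M - (M - m) / 2 / (Nat.card V : ℝ) ^ Nat.card V) := by
  set n := Nat.card V with hn
  let c : ℕ → ℝ := fun s => (M - m) / 2 / (n : ℝ) ^ s
  have hc0 : ∀ s, 0 ≤ c s := fun s => by
    have : 0 ≤ M - m := sub_nonneg.2 hmM
    positivity
  have hcs : ∀ s, c (s + 1) = c s / n := fun s => by simp only [c, pow_succ, div_mul_eq_div_div]
  have hc1 : ∀ s, c s ≤ (M - m) / 2 := by
    intro s
    -- For empty `V` the quotient is `0` when `s > 0`, by the convention for division by zero.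
    rcases Nat.eq_zero_or_pos n with h | h
    · rcases s with _ | s
      · simp [c]
      · simp only [c, h, Nat.cast_zero, pow_succ, mul_zero, div_zero]
        linarith
    · exact div_le_self (by linarith) (one_le_pow₀ (by exact_mod_cast h))
  let Lo : ℕ → Set V := fun s => {i | i ∉ F ∧ x.state (t + s) i < m + c s}
  let Hi : ℕ → Set V := fun s => {i | i ∉ F ∧ M - c s < x.state (t + s) i}
  have hlo := fun s => hx.le_state_add hG hF hm s
  have hhi := fun s => hx.state_add_le hG hF hM s
  have hLo : ∀ s, Lo (s + 1) ⊆ Lo s := by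
    rintro s i ⟨hi, hlt⟩
    refine ⟨hi, ?_⟩
    by_contra! hge
    have := hx.lower_bound hG hF (hlo s) (hc0 s) hi (Or.inl hge)
    rw [hcs] at hlt
    exact absurd hlt (not_lt.2 this)
  have hHi : ∀ s, Hi (s + 1) ⊆ Hi s := by
    rintro s i ⟨hi, hlt⟩
    refine ⟨hi, ?_⟩
    by_contra! hge
    have := hx.upper_bound hG hF (hhi s) (hc0 s) hi (Or.inl hge)
    rw [hcs] at hlt
    exact absurd hlt (not_lt.2 this)
  have hdisj : ∀ s, ∀ i ∈ Lo s, i ∉ Hi s := by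
    rintro s i ⟨-, h1⟩ ⟨-, h2⟩
    have := hc1 s
    linarith
  -- While both sets are nonempty, each round removes a node from one of them.
  have hcount : ∀ s, (Lo s).Nonempty → (Hi s).Nonempty → (Lo s).ncard + (Hi s).ncard + s ≤ n := by
    intro s
    induction s with
    | zero =>
      intro _ _
      rw [← Set.ncard_union_eq (Set.disjoint_left.2 (hdisj 0)), hn]
      exact Set.ncard_le_card _
    | succ s ih =>
      intro h1 h2
      have hle := ih (h1.mono (hLo s)) (h2.mono (hHi s))
      have hLle := Set.ncard_le_ncard (hLo s)
      have hHle := Set.ncard_le_ncard (hHi s)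
      suffices hlt : (Lo (s + 1)).ncard < (Lo s).ncard ∨ (Hi (s + 1)).ncard < (Hi s).ncard by
        omega
      rcases hsource.exists_not_covered hF (h1.mono (hLo s)) (h2.mono (hHi s))
        (fun i hi => hi.1) (fun i hi => hi.1) (hdisj s) with ⟨i, hi, hcov⟩ | ⟨i, hi, hcov⟩
      · refine Or.inl (Set.ncard_lt_ncard ⟨hLo s, fun hsub => ?_⟩)
        have hlt := (hsub hi).2
        rw [hcs] at hlt
        refine absurd hlt (not_lt.2 (hx.lower_bound hG hF (hlo s) (hc0 s) hi.1 (Or.inr ?_)))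
        rintro ⟨S, hS, hSc⟩
        exact hcov ⟨S, hS, fun j hji hj hjL => hSc j hji hj (not_lt.1 fun h => hjL ⟨hj, h⟩)⟩
      · refine Or.inr (Set.ncard_lt_ncard ⟨hHi s, fun hsub => ?_⟩)
        have hlt := (hsub hi).2
        rw [hcs] at hlt
        refine absurd hlt (not_lt.2 (hx.upper_bound hG hF (hhi s) (hc0 s) hi.1 (Or.inr ?_)))
        rintro ⟨S, hS, hSc⟩
        exact hcov ⟨S, hS, fun j hji hj hjL => hSc j hji hj (not_lt.1 fun h => hjL ⟨hj, h⟩)⟩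
  by_contra! hcon
  obtain ⟨⟨i, hi, hi'⟩, ⟨j, hj, hj'⟩⟩ := hcon
  have hi2 : i ∈ Lo n := ⟨hi, hi'⟩
  have hj2 : j ∈ Hi n := ⟨hj, hj'⟩
  have h1 := hcount n ⟨i, hi2⟩ ⟨j, hj2⟩
  have h2 : 0 < (Lo n).ncard := (Set.ncard_pos).2 ⟨i, hi2⟩
  omega

theorem iInf_le_of_notMem [Finite V] {F : Set V} (v : V → ℝ) : ∀ j ∉ F, ⨅ k : ↥Fᶜ, v k ≤ v j :=
  fun j hj => ciInf_le (Set.finite_range fun k : ↥Fᶜ => v k).bddBelow ⟨j, hj⟩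

theorem le_iSup_of_notMem [Finite V] {F : Set V} (v : V → ℝ) : ∀ j ∉ F, v j ≤ ⨆ k : ↥Fᶜ, v k :=
  fun j hj => le_ciSup (Set.finite_range fun k : ↥Fᶜ => v k).bddAbove ⟨j, hj⟩

theorem IsExecution.validity [Finite V] (hG : ∀ i, ¬ G.Adj i i) {dflt : ℝ} {F : Set V}
    (hF : Feasible 𝓕 F) {x : Run V} (hx : IsExecution G (trimmedMean G 𝓕) dflt F x) :
    Validity F x.state := fun t i hi =>
  ⟨hx.le_state_add hG hF (iInf_le_of_notMem (x.state t)) 1 i hi,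
    hx.state_add_le hG hF (le_iSup_of_notMem (x.state t)) 1 i hi⟩

/-- A nonnegative antitone sequence that shrinks by a fixed factor `q < 1` over every `n` steps
tends to zero. -/
theorem tendsto_zero_of_antitone_of_contraction {d : ℕ → ℝ} (hd : Antitone d) (h0 : ∀ t, 0 ≤ d t)
    {q : ℝ} (hq : q < 1) {n : ℕ} (hdq : ∀ t, d (t + n) ≤ q * d t) :
    Filter.Tendsto d Filter.atTop (nhds 0) := by
  have hlim := tendsto_atTop_ciInf hd ⟨0, by rintro _ ⟨t, rfl⟩; exact h0 t⟩
  set l := ⨅ t, d t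
  have hl0 : 0 ≤ l := ge_of_tendsto' hlim h0
  have hle : l ≤ q * l := le_of_tendsto_of_tendsto'
    ((Filter.tendsto_add_atTop_iff_nat n).2 hlim) (hlim.const_mul q) hdq
  have hl : l = 0 := by nlinarith
  rwa [hl] at hlim

theorem IsExecution.convergence [Finite V] (hG : ∀ i, ¬ G.Adj i i)
    (hsource : SourceCondition G 𝓕) {dflt : ℝ} {F : Set V} (hF : Feasible 𝓕 F) {x : Run V}
    (hx : IsExecution G (trimmedMean G 𝓕) dflt F x) : Convergence F x.state := by
  intro i j hi hj
  let m : ℕ → ℝ := fun t => ⨅ k : ↥Fᶜ, x.state t k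
  let M : ℕ → ℝ := fun t => ⨆ k : ↥Fᶜ, x.state t k
  have hm : ∀ t, ∀ k ∉ F, m t ≤ x.state t k := fun t => iInf_le_of_notMem (x.state t)
  have hM : ∀ t, ∀ k ∉ F, x.state t k ≤ M t := fun t => le_iSup_of_notMem (x.state t)
  have : Nonempty ↥Fᶜ := ⟨⟨i, hi⟩⟩
  have hle_m : ∀ t a, (∀ k ∉ F, a ≤ x.state t k) → a ≤ m t :=
    fun t a h => le_ciInf fun k => h k k.2
  have hM_le : ∀ t a, (∀ k ∉ F, x.state t k ≤ a) → M t ≤ a :=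
    fun t a h => ciSup_le fun k => h k k.2
  have hmM : ∀ t, m t ≤ M t := fun t => (hm t i hi).trans (hM t i hi)
  have hm_add : ∀ t s, m t ≤ m (t + s) := fun t s => hle_m _ _ (hx.le_state_add hG hF (hm t) s)
  have hM_add : ∀ t s, M (t + s) ≤ M t := fun t s => hM_le _ _ (hx.state_add_le hG hF (hM t) s)
  have hanti : Antitone fun t => M t - m t := antitone_nat_of_succ_le fun t =>
    sub_le_sub (hM_add t 1) (hm_add t 1)
  have hn : (0 : ℝ) < (Nat.card V : ℝ) ^ Nat.card V := by
    have : Nonempty V := ⟨i⟩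
    have : 0 < Nat.card V := Nat.card_pos
    positivity
  have hlim : Filter.Tendsto (fun t => M t - m t) Filter.atTop (nhds 0) := by
    refine tendsto_zero_of_antitone_of_contraction hanti (fun t => sub_nonneg.2 (hmM t))
      (q := 1 - 1 / 2 / (Nat.card V : ℝ) ^ Nat.card V) (sub_lt_self _ (by positivity))
      (n := Nat.card V) fun t => ?_
    have heq : (1 - 1 / 2 / (Nat.card V : ℝ) ^ Nat.card V) * (M t - m t) =
        M t - m t - (M t - m t) / 2 / (Nat.card V : ℝ) ^ Nat.card V := by ring
    rw [heq]
    rcases hx.contraction hG hsource hF (hmM t) (hm t) (hM t) with h | h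
    · linarith [hle_m _ _ h, hM_add t (Nat.card V)]
    · linarith [hM_le _ _ h, hm_add t (Nat.card V)]
  refine squeeze_zero_norm (fun t => ?_) hlim
  rw [Real.norm_eq_abs, abs_sub_le_iff]
  constructor <;> linarith [hm t i hi, hm t j hj, hM t i hi, hM t j hj]

end IterConsensus

theorem theorem2 {V : Type*} [Finite V] (G : Digraph V) (hG : ∀ i, ¬ G.Adj i i)
    (𝓕 : Set (Set V)) (hsource : IterConsensus.SourceCondition G 𝓕) :
    (∀ dflt : ℝ,
      IterConsensus.SatisfiesValidityAndConvergence G 𝓕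
        (IterConsensus.trimmedMean G 𝓕) dflt) ∧
    (∃ A : IterConsensus.IABC G, A.ImplementsTrimmedMean 𝓕 ∧ A.Correct 𝓕) := by
  have hmain : ∀ dflt : ℝ, IterConsensus.SatisfiesValidityAndConvergence G 𝓕
      (IterConsensus.trimmedMean G 𝓕) dflt := fun _ _ hF _ hx =>
    ⟨hx.validity hG hF, hx.convergence hG hsource hF⟩
  refine ⟨hmain, ?_⟩
  choose Z hZ using IterConsensus.exists_trimmedMean hG 𝓕
  refine ⟨⟨0, Z⟩, hZ, fun F hF x hx => hmain 0 F hF x ⟨hx.transmit, fun t i hi => ?_⟩⟩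
  rw [hx.update t i hi]
  exact hZ i _
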